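/- Let $\kappa\in\mathbb{R}$ and let $(X,d)$ be a $\mathrm{CBB}(\kappa)$ space, i.e. an Alexandrov space of curvature $\ge\kappa$. Then $\operatorname{Curv} X\ge\kappa$. Here the notions are as follows. - $(M_\kappa,d_\kappa)$ is the model plane of constant curvature $\kappa$: the round sphere of radius $1/\sqrt{\kappa}$ with its intrinsic metric if $\kappa>0$, the Euclidean plane if $\kappa=0$, and the hyperbolic plane with its distance multiplied by $1/\sqrt{-\kappa}$ if $\kappa<0$. A triangle in a metric space is a triple of points; it is called large if $\kappa>0$ and its perimeter is at least $2\pi/\sqrt{\kappa}$. A comparison triangle of a triangle $(a_1,a_2,a_3)$ in $X$ is a triangle $(\overline a_1,\overline a_2,\overline a_3)$ in $M_\kappa$ with $d_\kappa(\overline a_i,\overline a_j)=d(a_i,a_j)$ for all $i,j$; if $(a_1,a_2,a_3)$ is not large, it exists and is unique up to isometries. - $(X,d)$ is a $\mathrm{CBB}(\kappa)$ space if it is a length space (the distance of two points is the infimum of the lengths of the paths joining them) and, for every quadruple $(p;x_1,x_2,x_3)$ of points of $X$ with $p\ne x_i$ for all $i$ such that none of the triangles $(p,x_i,x_j)$,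 $i<j$, is large, one has $$\widetilde\angle_\kappa(p;x_1,x_2)+\widetilde\angle_\kappa(p;x_2,x_3)+\widetilde\angle_\kappa(p;x_3,x_1)\le 2\pi,$$ where $\widetilde\angle_\kappa(p;x,y)$ is the angle at $\overline p$ of a comparison triangle $(\overline p,\overline x,\overline y)$ in $M_\kappa$ of $(p,x,y)$. Completeness is not required. - The circumradius of a triangle $(a_1,a_2,a_3)$ in a metric space $Y$ is $$r(a_1,a_2,a_3)=\inf_{x\in Y}\max_{i=1,2,3} d_Y(x,a_i).$$ - $\operatorname{Curv}X\ge\kappa$ means that, for every triangle $(a_1,a_2,a_3)$ in $X$ that is not large and every comparison triangle $(\overline a_1,\overline a_2,\overline a_3)$ of it in $M_\kappa$, $$r(\overline a_1,\overline a_2,\overline a_3)\le r(a_1,a_2,a_3).$$ -/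

import Mathlib

/-- The model plane `M_κ` of constant curvature `κ`: the simply connected complete surface of
constant curvature `κ`, realised inside `ℝ × ℝ²` by the equation `t² + κ ‖v‖² = 1`, taking the
sheet `t > 0` when `κ ≤ 0`.
* For `κ > 0`, `(t, v) ↦ (t / √κ, v)` identifies it with the round sphere of radius `1 / √κ`.
* For `κ = 0`, one has `t = 1`, and it is the Euclidean plane.
* For `κ < 0`, `(t, v) ↦ (t, √(-κ) v)` identifies it with the upper sheet of the unit
  hyperboloid. -/
structure ModelPlane (κ : ℝ) where
  t : ℝ
  v : EuclideanSpace ℝ (Fin 2)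
  eqn : t ^ 2 + κ * ‖v‖ ^ 2 = 1
  pos : κ ≤ 0 → 0 < t

/-- The intrinsic distance `d_κ` of the model plane: `1 / √κ` times the angular distance on the
unit sphere for `κ > 0`, the Euclidean distance for `κ = 0`, and `1 / √(-κ)` times the hyperbolic
distance of the hyperboloid model for `κ < 0`. -/
noncomputable instance ModelPlane.instDist (κ : ℝ) : Dist (ModelPlane κ) where
  dist P Q :=
    if 0 < κ then Real.arccos (P.t * Q.t + κ * inner ℝ P.v Q.v) / √κ
    else if κ = 0 then ‖P.v - Q.v‖
    else Real.arcosh (P.t * Q.t + κ * inner ℝ P.v Q.v) / √(-κ)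

/-- The triangle `(a, b, c)` is not large for curvature `κ`: there is no restriction for `κ ≤ 0`,
and its perimeter is less than `2π / √κ` for `κ > 0`. -/
def IsSmallTriangle {X : Type*} [Dist X] (κ : ℝ) (a b c : X) : Prop :=
  0 < κ → dist a b + dist b c + dist c a < 2 * Real.pi / √κ

/-- `(a', b', c')` is a comparison triangle in `M_κ` for the triangle `(a, b, c)` in `X`. -/
def IsComparisonTriangle {X : Type*} [Dist X] (κ : ℝ) (a b c : X) (a' b' c' : ModelPlane κ) :
    Prop :=
  dist a' b' = dist a b ∧ dist b' c' = dist b c ∧ dist c' a' = dist c a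

/-- The circumradius `inf_x max (d(x, a), d(x, b), d(x, c))` of the triangle `(a, b, c)`. -/
noncomputable def circumradius {X : Type*} [Dist X] (a b c : X) : ℝ :=
  ⨅ x : X, max (dist x a) (max (dist x b) (dist x c))

/-- `Curv X ≥ κ`: every triangle of `X` (large ones being excluded if `κ > 0`) has circumradius at
least the circumradius of its comparison triangle in `M_κ`. -/
def CurvGE (κ : ℝ) (X : Type*) [MetricSpace X] : Prop :=
  ∀ a b c : X, IsSmallTriangle κ a b c →
    ∀ a' b' c' : ModelPlane κ, IsComparisonTriangle κ a b c a' b' c' →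
      circumradius a' b' c' ≤ circumradius a b c

/-- The model angle at `p` of the triple `(p, x, y)`: the angle at the vertex corresponding to `p`
of the comparison triangle in `M_κ`, given by the law of cosines in `M_κ`. It is meaningful
when `p ≠ x`, `p ≠ y` and `(p, x, y)` is not large. -/
noncomputable def modelAngle {X : Type*} [Dist X] (κ : ℝ) (p x y : X) : ℝ :=
  let a := dist x y
  let b := dist p x
  let c := dist p y
  if 0 < κ then
    Real.arccos ((Real.cos (√κ * a) - Real.cos (√κ * b) * Real.cos (√κ * c)) /
      (Real.sin (√κ * b) * Real.sin (√κ * c)))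
  else if κ = 0 then
    Real.arccos ((b ^ 2 + c ^ 2 - a ^ 2) / (2 * b * c))
  else
    Real.arccos ((Real.cosh (√(-κ) * b) * Real.cosh (√(-κ) * c) - Real.cosh (√(-κ) * a)) /
      (Real.sinh (√(-κ) * b) * Real.sinh (√(-κ) * c)))

/-- Length spaces: the distance of two points is the infimum of the lengths (total variations) of
the paths that join them. -/
def IsLengthSpace (X : Type*) [MetricSpace X] : Prop :=
  ∀ x y : X, edist x y = ⨅ γ : Path x y, eVariationOn γ Set.univ

/-- `X` is a `CBB(κ)` space (an Alexandrov space of curvature `≥ κ`): a length space in which, for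
every quadruple `(p; x, y, z)`, the three model angles at `p` add up to at most `2π` whenever all
three of them are defined. Completeness is not required. -/
structure IsCBB (κ : ℝ) (X : Type*) [MetricSpace X] : Prop where
  isLengthSpace : IsLengthSpace X
  four_point : ∀ p x y z : X, p ≠ x → p ≠ y → p ≠ z →
    IsSmallTriangle κ p x y → IsSmallTriangle κ p y z → IsSmallTriangle κ p z x →
      modelAngle κ p x y + modelAngle κ p y z + modelAngle κ p z x ≤ 2 * Real.pi

/-!
Fix a point `x` of `X`, let `r i` be its distances to the vertices of the triangle, and let
`r i ≤ R`; one has to find a point of `M_κ` within `R` of the vertices of the comparison triangle.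
If `0 < κ` and `π / (2 √κ) ≤ R`, then the pole of a closed hemisphere that contains the three
vertices will do.

Otherwise, write `md_κ` for the solution of `f'' + κ f = 1`, `f 0 = f' 0 = 0`, and put
`M = md_κ R`. The model angles at `x` add up to at most `2π`, so they are dominated by the mutual
angles of three vectors in the plane. The Gram matrix of these vectors is positive semidefinite,
and the law of cosines turns this into `∑ w i * w j * md_κ (d i j) ≤ M * (2 - κ * M)` for all
weights `w`. These distances `d i j` are also those of the comparison triangle in `M_κ`. Choose
the weights that maximize the left side and project the barycenter of the comparison triangle in
the ambient space radially to `M_κ`: the first order condition at the maximum says that the point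
so obtained has distance at most `R` from each vertex.
-/

open Real Set Filter
open scoped Topology RealInnerProductSpace

theorem bilinForm_apply_le_apply_self_of_isMaxOn {E : Type*} [AddCommGroup E] [Module ℝ E]
    {B : LinearMap.BilinForm ℝ E} (hB : B.IsSymm) {K : Set E} (hK : Convex ℝ K) {x y : E}
    (hx : x ∈ K) (hy : y ∈ K) (hmax : IsMaxOn (fun z => B z z) K x) : B x y ≤ B x x := by
  have hslope : ∀ s ∈ Ioc (0 : ℝ) 1, 2 * (B x y - B x x) + s * (B x x - 2 * B x y + B y y) ≤ 0 := by
    intro s hs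
    have hz : B ((1 - s) • x + s • y) ((1 - s) • x + s • y) ≤ B x x :=
      hmax (hK hx hy (sub_nonneg.2 hs.2) hs.1.le (sub_add_cancel 1 s))
    simp only [map_add, map_smul, LinearMap.add_apply, LinearMap.smul_apply, smul_eq_mul,
      hB.eq y x] at hz
    refine nonpos_of_mul_nonpos_right ?_ hs.1
    linarith
  have hlim : Tendsto (fun s => 2 * (B x y - B x x) + s * (B x x - 2 * B x y + B y y))
      (𝓝[>] 0) (𝓝 (2 * (B x y - B x x))) := by
    refine tendsto_nhdsWithin_of_tendsto_nhds (Continuous.tendsto' (by fun_prop) _ _ (by ring))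
  have := le_of_tendsto hlim (eventually_of_mem (Ioc_mem_nhdsGT one_pos) hslope)
  linarith

theorem exists_mem_stdSimplex_forall_sum_mul_le {ι : Type*} [Fintype ι] [Nonempty ι]
    {A : ι → ι → ℝ} (hA : ∀ i j, A i j = A j i) :
    ∃ w ∈ stdSimplex ℝ ι, ∀ k, ∑ j, w j * A k j ≤ ∑ i, w i * ∑ j, w j * A i j := by
  classical
  let B : LinearMap.BilinForm ℝ (ι → ℝ) := Matrix.toBilin' (Matrix.of A)
  have hB : ∀ u v : ι → ℝ, B u v = ∑ i, u i * ∑ j, v j * A i j := fun u v => by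
    simp only [B, Matrix.toBilin'_apply', dotProduct, Matrix.mulVec, Matrix.of_apply, mul_comm]
  have hsymm : B.IsSymm :=
    Matrix.isSymm_toBilin'_iff_isSymm.2 (Matrix.IsSymm.ext fun i j => hA j i)
  have hcont : Continuous fun w => B w w := by simp only [hB]; fun_prop
  obtain ⟨w, hw, hmax⟩ := (isCompact_stdSimplex ℝ ι).exists_isMaxOn
    ⟨_, single_mem_stdSimplex ℝ (Classical.arbitrary ι)⟩ hcont.continuousOn
  refine ⟨w, hw, fun k => ?_⟩
  have hk := bilinForm_apply_le_apply_self_of_isMaxOn hsymm (convex_stdSimplex ℝ ι) hw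
    (single_mem_stdSimplex ℝ k) hmax
  rw [hsymm.eq, hB, hB] at hk
  simpa [Pi.single_apply] using hk

theorem exists_ne_zero_forall_nonneg {K V ι : Type*} [Field K] [LinearOrder K]
    [IsStrictOrderedRing K] [AddCommGroup V] [Module K V] [FiniteDimensional K V] [Fintype ι]
    [Nonempty ι] (φ : ι → Module.Dual K V) (h : Fintype.card ι ≤ Module.finrank K V) :
    ∃ u : V, u ≠ 0 ∧ ∀ i, 0 ≤ φ i u := by
  by_cases hφ : Function.Injective (LinearMap.pi φ)
  · have hdim : Module.finrank K V = Module.finrank K (ι → K) :=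
      (LinearMap.finrank_le_finrank_of_injective hφ).antisymm (by simpa using h)
    obtain ⟨u, hu⟩ := (LinearMap.injective_iff_surjective_of_finrank_eq_finrank hdim).1 hφ 1
    have hone : ∀ i, φ i u = 1 := congrFun hu
    refine ⟨u, ?_, fun i => (hone i).symm ▸ zero_le_one⟩
    rintro rfl
    simpa using hone (Classical.arbitrary ι)
  · obtain ⟨u, hu, hne⟩ : ∃ u, LinearMap.pi φ u = 0 ∧ u ≠ 0 := by
      simpa [injective_iff_map_eq_zero] using hφ
    exact ⟨u, hne, fun i => (congrFun hu i).ge⟩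

theorem exists_forall_ne_cos_sub_le_cos {A : Fin 3 → Fin 3 → ℝ} (hsymm : ∀ i j, A i j = A j i)
    (hnonneg : ∀ i j, 0 ≤ A i j) (hsum : A 0 1 + A 1 2 + A 2 0 ≤ 2 * π) :
    ∃ θ : Fin 3 → ℝ, ∀ i j, i ≠ j → cos (θ i - θ j) ≤ cos (A i j) := by
  have ⟨t, h12, h20⟩ : ∃ t, cos t ≤ cos (A 1 2) ∧ cos (A 0 1 + t) ≤ cos (A 2 0) := by
    rcases le_total π (A 0 1 + A 1 2) with hπ | hπ
    · refine ⟨A 1 2, le_rfl, ?_⟩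
      rw [← cos_two_pi_sub]
      exact cos_le_cos_of_nonneg_of_le_pi (hnonneg 2 0) (by linarith) (by linarith)
    · refine ⟨π - A 0 1, cos_le_cos_of_nonneg_of_le_pi (hnonneg 1 2) ?_ ?_, ?_⟩
      · linarith [hnonneg 0 1]
      · linarith
      · rw [add_sub_cancel, cos_pi]
        exact neg_one_le_cos _
  let θ : Fin 3 → ℝ := ![A 0 1, 0, -t]
  have h01 : cos (θ 0 - θ 1) ≤ cos (A 0 1) := by simp [θ]
  replace h12 : cos (θ 1 - θ 2) ≤ cos (A 1 2) := by simpa [θ] using h12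
  replace h20 : cos (θ 2 - θ 0) ≤ cos (A 2 0) := by
    rw [← cos_neg]
    simpa [θ] using h20
  have swap : ∀ {i j}, cos (θ i - θ j) ≤ cos (A i j) → cos (θ j - θ i) ≤ cos (A j i) := by
    intro i j hij
    rwa [← cos_neg, neg_sub, hsymm]
  refine ⟨θ, fun i j hij => ?_⟩
  fin_cases i <;> fin_cases j
  exacts [absurd rfl hij, h01, swap h20, swap h01, absurd rfl hij, h12, h20, swap h12,
    absurd rfl hij]

theorem sum_mul_sum_mul_cos_sub_nonneg {ι : Type*} [Fintype ι] (w θ : ι → ℝ) :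
    0 ≤ ∑ i, w i * ∑ j, w j * cos (θ i - θ j) := by
  have hsq : ∑ i, w i * ∑ j, w j * cos (θ i - θ j) =
      (∑ i, w i * cos (θ i)) ^ 2 + (∑ i, w i * sin (θ i)) ^ 2 := by
    simp only [sq, Finset.sum_mul_sum]
    simp only [cos_sub, Finset.mul_sum, ← Finset.sum_add_distrib]
    exact Finset.sum_congr rfl fun i _ => Finset.sum_congr rfl fun j _ => by ring
  rw [hsq]
  positivity

/-- The generalized versine `md_κ`, the solution of `f'' + κ f = 1`, `f 0 = f' 0 = 0`. It replaces
`cos (√κ * d)`, `d ^ 2` and `cosh (√(-κ) * d)` by a single function for which the law of cosines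
has the same form for all `κ`. -/
noncomputable def modelVersine (κ d : ℝ) : ℝ :=
  if 0 < κ then (1 - cos (√κ * d)) / κ
  else if κ = 0 then d ^ 2 / 2
  else (1 - cosh (√(-κ) * d)) / κ

/-- The generalized sine `sn_κ`, the derivative of `modelVersine κ`. -/
noncomputable def modelSine (κ d : ℝ) : ℝ :=
  if 0 < κ then sin (√κ * d) / √κ
  else if κ = 0 then d
  else sinh (√(-κ) * d) / √(-κ)

section ModelTrigonometry

variable {κ : ℝ}

theorem modelVersine_of_pos (hκ : 0 < κ) (d : ℝ) : modelVersine κ d = (1 - cos (√κ * d)) / κ :=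
  if_pos hκ

theorem modelVersine_curvature_zero (d : ℝ) : modelVersine 0 d = d ^ 2 / 2 :=
  (if_neg (lt_irrefl _)).trans (if_pos rfl)

theorem modelVersine_of_neg (hκ : κ < 0) (d : ℝ) :
    modelVersine κ d = (1 - cosh (√(-κ) * d)) / κ :=
  (if_neg hκ.not_gt).trans (if_neg hκ.ne)

theorem modelSine_of_pos (hκ : 0 < κ) (d : ℝ) : modelSine κ d = sin (√κ * d) / √κ :=
  if_pos hκ

theorem modelSine_curvature_zero (d : ℝ) : modelSine 0 d = d :=
  (if_neg (lt_irrefl _)).trans (if_pos rfl)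

theorem modelSine_of_neg (hκ : κ < 0) (d : ℝ) : modelSine κ d = sinh (√(-κ) * d) / √(-κ) :=
  (if_neg hκ.not_gt).trans (if_neg hκ.ne)

theorem modelVersine_add (κ b c : ℝ) :
    modelVersine κ (b + c) = modelVersine κ b + modelVersine κ c
      - κ * modelVersine κ b * modelVersine κ c + modelSine κ b * modelSine κ c := by
  rcases lt_trichotomy κ 0 with hκ | rfl | hκ
  · have := neg_pos.2 hκ
    simp only [modelVersine_of_neg hκ, modelSine_of_neg hκ, mul_add, cosh_add, div_mul_div_comm,
      mul_self_sqrt this.le]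
    field_simp
    ring
  · simp only [modelVersine_curvature_zero, modelSine_curvature_zero]
    ring
  · simp only [modelVersine_of_pos hκ, modelSine_of_pos hκ, mul_add, cos_add, div_mul_div_comm,
      mul_self_sqrt hκ.le]
    field_simp
    ring

theorem modelVersine_neg (κ d : ℝ) : modelVersine κ (-d) = modelVersine κ d := by
  simp only [modelVersine, mul_neg, cos_neg, cosh_neg, neg_sq]

theorem modelVersine_abs (κ d : ℝ) : modelVersine κ |d| = modelVersine κ d := by
  rcases abs_choice d with hd | hd <;> rw [hd]
  exact modelVersine_neg κ d

theorem modelSine_neg (κ d : ℝ) : modelSine κ (-d) = -modelSine κ d := by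
  simp only [modelSine, mul_neg, sin_neg, sinh_neg, neg_div]
  split_ifs <;> rfl

theorem modelVersine_sub (κ b c : ℝ) :
    modelVersine κ (b - c) = modelVersine κ b + modelVersine κ c
      - κ * modelVersine κ b * modelVersine κ c - modelSine κ b * modelSine κ c := by
  rw [sub_eq_add_neg, modelVersine_add, modelVersine_neg, modelSine_neg, mul_neg, ← sub_eq_add_neg]

theorem modelSine_sq (κ d : ℝ) :
    modelSine κ d ^ 2 = modelVersine κ d * (2 - κ * modelVersine κ d) := by
  rcases lt_trichotomy κ 0 with hκ | rfl | hκ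
  · have := neg_pos.2 hκ
    have hκ0 := hκ.ne
    rw [modelVersine_of_neg hκ, modelSine_of_neg hκ, div_pow, sq_sqrt this.le, sinh_sq]
    field_simp
    ring
  · simp only [modelVersine_curvature_zero, modelSine_curvature_zero]
    ring
  · rw [modelVersine_of_pos hκ, modelSine_of_pos hκ, div_pow, sq_sqrt hκ.le, sin_sq]
    field_simp
    ring

theorem modelSine_pos {d : ℝ} (hd : 0 < d) (hdπ : 0 < κ → √κ * d < π) : 0 < modelSine κ d := by
  rcases lt_trichotomy κ 0 with hκ | rfl | hκ
  · have := sqrt_pos.2 (neg_pos.2 hκ)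
    rw [modelSine_of_neg hκ]
    exact div_pos (sinh_pos_iff.2 (mul_pos this hd)) this
  · rwa [modelSine_curvature_zero]
  · have := sqrt_pos.2 hκ
    rw [modelSine_of_pos hκ]
    exact div_pos (sin_pos_of_pos_of_lt_pi (mul_pos this hd) (hdπ hκ)) this

/-- The interval of lengths that occur as distances in `M_κ`: `[0, π / √κ]` if `0 < κ`, and
`[0, ∞)` otherwise. -/
def modelDistances (κ : ℝ) : Set ℝ := {d | 0 ≤ d ∧ (0 < κ → √κ * d ≤ π)}

theorem strictMonoOn_modelVersine (κ : ℝ) : StrictMonoOn (modelVersine κ) (modelDistances κ) := by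
  intro b hb c hc hbc
  rcases lt_trichotomy κ 0 with hκ | rfl | hκ
  · have hk := sqrt_pos.2 (neg_pos.2 hκ)
    rw [modelVersine_of_neg hκ, modelVersine_of_neg hκ, div_lt_div_right_of_neg hκ,
      sub_lt_sub_iff_left]
    exact cosh_strictMonoOn (mul_nonneg hk.le hb.1) (mul_nonneg hk.le hc.1)
      (mul_lt_mul_of_pos_left hbc hk)
  · rw [modelVersine_curvature_zero, modelVersine_curvature_zero]
    linarith [pow_lt_pow_left₀ hbc hb.1 two_ne_zero]
  · have hk := sqrt_pos.2 hκ
    rw [modelVersine_of_pos hκ, modelVersine_of_pos hκ, div_lt_div_iff_of_pos_right hκ,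
      sub_lt_sub_iff_left]
    exact strictAntiOn_cos ⟨mul_nonneg hk.le hb.1, hb.2 hκ⟩ ⟨mul_nonneg hk.le hc.1, hc.2 hκ⟩
      (mul_lt_mul_of_pos_left hbc hk)

theorem zero_mem_modelDistances (κ : ℝ) : 0 ∈ modelDistances κ :=
  ⟨le_rfl, fun _ => by rw [mul_zero]; exact pi_pos.le⟩

theorem modelVersine_zero (κ : ℝ) : modelVersine κ 0 = 0 := by
  simp [modelVersine]

theorem modelVersine_nonneg {d : ℝ} (hd : d ∈ modelDistances κ) : 0 ≤ modelVersine κ d :=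
  modelVersine_zero κ ▸
    (strictMonoOn_modelVersine κ).monotoneOn (zero_mem_modelDistances κ) hd hd.1

theorem curvature_mul_modelVersine_lt_one {d : ℝ} (hd : 0 ≤ d) (hdπ : 0 < κ → √κ * d < π / 2) :
    κ * modelVersine κ d < 1 := by
  rcases le_or_gt κ 0 with hκ | hκ
  · have := modelVersine_nonneg (κ := κ) ⟨hd, fun h => absurd h hκ.not_gt⟩
    linarith [mul_nonpos_of_nonpos_of_nonneg hκ this]
  · rw [modelVersine_of_pos hκ, mul_div_cancel₀ _ hκ.ne', sub_lt_self_iff]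
    exact cos_pos_of_mem_Ioo ⟨by linarith [pi_pos, mul_nonneg (sqrt_nonneg κ) hd], hdπ hκ⟩

end ModelTrigonometry

section ModelAngle

variable {κ : ℝ} {X : Type*}

theorem modelAngle_nonneg [Dist X] (κ : ℝ) (p x y : X) : 0 ≤ modelAngle κ p x y := by
  unfold modelAngle
  dsimp only
  split_ifs <;> exact arccos_nonneg _

theorem modelAngle_eq_arccos [Dist X] (κ : ℝ) (p x y : X) :
    modelAngle κ p x y = arccos
      ((modelVersine κ (dist p x) + modelVersine κ (dist p y)
        - κ * modelVersine κ (dist p x) * modelVersine κ (dist p y) - modelVersine κ (dist x y)) /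
        (modelSine κ (dist p x) * modelSine κ (dist p y))) := by
  unfold modelAngle
  rcases lt_trichotomy κ 0 with hκ | rfl | hκ
  · have hκ' := neg_pos.2 hκ
    have hκ0 := hκ.ne
    rw [if_neg hκ.not_gt, if_neg hκ0]
    simp only [modelVersine_of_neg hκ, modelSine_of_neg hκ, div_mul_div_comm,
      mul_self_sqrt hκ'.le]
    rw [← div_div_div_cancel_right₀ hκ'.ne']
    congr 2
    field_simp
    ring
  · rw [if_neg (lt_irrefl _), if_pos rfl]
    simp only [modelVersine_curvature_zero, modelSine_curvature_zero]
    rw [← div_div_div_cancel_right₀ (two_ne_zero' ℝ)]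
    congr 2 <;> ring
  · rw [if_pos hκ]
    simp only [modelVersine_of_pos hκ, modelSine_of_pos hκ, div_mul_div_comm, mul_self_sqrt hκ.le]
    rw [← div_div_div_cancel_right₀ hκ.ne']
    congr 2
    field_simp
    ring

variable [PseudoMetricSpace X]

theorem modelAngle_comm (κ : ℝ) (p x y : X) : modelAngle κ p x y = modelAngle κ p y x := by
  rw [modelAngle_eq_arccos, modelAngle_eq_arccos, dist_comm x y]
  congr 1
  ring

theorem modelVersine_dist_eq_sub_cos_modelAngle {p x y : X} (hx : 0 < dist p x) (hy : 0 < dist p y)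
    (hπ : 0 < κ → √κ * (dist p x + dist p y) ≤ π) :
    modelVersine κ (dist x y) = modelVersine κ (dist p x) + modelVersine κ (dist p y)
      - κ * modelVersine κ (dist p x) * modelVersine κ (dist p y)
      - modelSine κ (dist p x) * modelSine κ (dist p y) * cos (modelAngle κ p x y) := by
  have hsin : 0 < modelSine κ (dist p x) * modelSine κ (dist p y) := by
    refine mul_pos (modelSine_pos hx fun hκ => ?_) (modelSine_pos hy fun hκ => ?_)
    · linarith [hπ hκ, mul_pos (sqrt_pos.2 hκ) hy]
    · linarith [hπ hκ, mul_pos (sqrt_pos.2 hκ) hx]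
  have hmem : ∀ d, 0 ≤ d → d ≤ dist p x + dist p y → d ∈ modelDistances κ := fun d hd hle =>
    ⟨hd, fun hκ => (mul_le_mul_of_nonneg_left hle (sqrt_nonneg κ)).trans (hπ hκ)⟩
  have hupper := dist_triangle_left x y p
  have hlower := abs_dist_sub_le x y p
  rw [dist_comm x p, dist_comm y p] at hlower
  have hxy := hmem _ dist_nonneg hupper
  have hadd := (strictMonoOn_modelVersine κ).monotoneOn hxy
    (hmem _ (by positivity) le_rfl) hupper
  have hsub := (strictMonoOn_modelVersine κ).monotoneOn
    (hmem _ (abs_nonneg _) (hlower.trans hupper)) hxy hlower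
  rw [modelVersine_add] at hadd
  rw [modelVersine_abs, modelVersine_sub] at hsub
  rw [modelAngle_eq_arccos, cos_arccos, mul_div_cancel₀ _ hsin.ne']
  · ring
  · rw [le_div_iff₀ hsin]
    linarith
  · rw [div_le_one hsin]
    linarith

end ModelAngle

theorem strictMonoOn_mul_two_sub (κ : ℝ) :
    StrictMonoOn (fun m : ℝ => m * (2 - κ * m)) {m | κ * m < 1} := by
  intro m (hm : κ * m < 1) n (hn : κ * n < 1) hmn
  have : 0 < (n - m) * (2 - κ * m - κ * n) := mul_pos (sub_pos.2 hmn) (by linarith)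
  dsimp only
  linarith

theorem exists_mul_two_sub_eq {κ F : ℝ} (hF : κ * F < 1) :
    ∃ g : ℝ, κ * g < 1 ∧ g * (2 - κ * g) = F := by
  have hσ := sqrt_pos.2 (sub_pos.2 hF)
  have hσsq := sq_sqrt (sub_pos.2 hF).le
  set σ := √(1 - κ * F)
  have hκg : κ * (F / (1 + σ)) = 1 - σ := by
    field_simp
    linarith
  refine ⟨F / (1 + σ), by linarith, ?_⟩
  rw [hκg]
  field_simp
  ring

theorem mul_lt_one_of_le {κ m M : ℝ} (hm : 0 ≤ m) (hmM : m ≤ M) (hM : κ * M < 1) : κ * m < 1 := by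
  rcases le_total κ 0 with hκ | hκ
  · linarith [mul_nonpos_of_nonpos_of_nonneg hκ hm]
  · exact (mul_le_mul_of_nonneg_left hmM hκ).trans_lt hM

theorem sum_mul_sum_mul_add_sub_sub {ι : Type*} [Fintype ι] {w : ι → ℝ} (hw : ∑ j, w j = 1) (κ : ℝ)
    (m : ι → ℝ) (C : ι → ι → ℝ) :
    ∑ i, w i * ∑ j, w j * (m i + m j - κ * m i * m j - C i j) =
      (∑ j, w j * m j) * (2 - κ * ∑ j, w j * m j) - ∑ i, w i * ∑ j, w j * C i j := by
  have hinner : ∀ i, ∑ j, w j * (m i + m j - κ * m i * m j - C i j) =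
      m i + (1 - κ * m i) * ∑ j, w j * m j - ∑ j, w j * C i j := by
    intro i
    have hterm : ∀ j, w j * (m i + m j - κ * m i * m j - C i j) =
        w j * m i + (1 - κ * m i) * (w j * m j) - w j * C i j := fun j => by ring
    simp only [hterm, Finset.sum_sub_distrib, Finset.sum_add_distrib, ← Finset.mul_sum,
      ← Finset.sum_mul, hw, one_mul]
  have hterm : ∀ i, w i * (m i + (1 - κ * m i) * ∑ j, w j * m j - ∑ j, w j * C i j) =
      w i * m i + w i * (∑ j, w j * m j) - w i * m i * (κ * ∑ j, w j * m j)
        - w i * ∑ j, w j * C i j := fun i => by ring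
  simp only [hinner, hterm, Finset.sum_sub_distrib, Finset.sum_add_distrib, ← Finset.sum_mul, hw]
  ring

namespace ModelPlane

variable {κ : ℝ}

/-- The form `t s + κ ⟪v, w⟫` of the ambient space `ℝ × ℝ²`, for which the model plane is (a sheet
of) the unit sphere. On the model plane it equals `cos (√κ * d)` for `0 < κ` and
`cosh (√(-κ) * d)` for `κ < 0`, where `d` is the distance. -/
noncomputable def form (P Q : ModelPlane κ) : ℝ := P.t * Q.t + κ * ⟪P.v, Q.v⟫

theorem form_self (P : ModelPlane κ) : form P P = 1 := by
  rw [form, real_inner_self_eq_norm_sq, ← sq]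
  exact P.eqn

theorem form_comm (P Q : ModelPlane κ) : form P Q = form Q P := by
  rw [form, form, mul_comm, real_inner_comm]

theorem abs_form_le_one (hκ : 0 < κ) (P Q : ModelPlane κ) : |form P Q| ≤ 1 := by
  have hsub : 0 ≤ (P.t - Q.t) ^ 2 + κ * ‖P.v - Q.v‖ ^ 2 := by positivity
  have hadd : 0 ≤ (P.t + Q.t) ^ 2 + κ * ‖P.v + Q.v‖ ^ 2 := by positivity
  rw [norm_sub_sq_real] at hsub
  rw [norm_add_sq_real] at hadd
  rw [form, abs_le]
  constructor <;> linarith [P.eqn, Q.eqn]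

theorem one_le_form (hκ : κ ≤ 0) (P Q : ModelPlane κ) : 1 ≤ form P Q := by
  have hcauchy : 1 - κ * (‖P.v‖ * ‖Q.v‖) ≤ P.t * Q.t := by
    refine le_of_sq_le_sq ?_ (mul_pos (P.pos hκ) (Q.pos hκ)).le
    have hprod : (P.t * Q.t) ^ 2 = (1 - κ * ‖P.v‖ ^ 2) * (1 - κ * ‖Q.v‖ ^ 2) := by
      linear_combination P.t ^ 2 * Q.eqn + (1 - κ * ‖Q.v‖ ^ 2) * P.eqn
    rw [hprod]
    linarith [mul_nonpos_of_nonpos_of_nonneg hκ (sq_nonneg (‖P.v‖ - ‖Q.v‖))]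
  have hinner := mul_le_mul_of_nonpos_left (real_inner_le_norm P.v Q.v) hκ
  rw [form]
  linarith

theorem dist_of_pos (hκ : 0 < κ) (P Q : ModelPlane κ) : dist P Q = arccos (form P Q) / √κ :=
  if_pos hκ

theorem dist_of_curvature_zero (P Q : ModelPlane 0) : dist P Q = ‖P.v - Q.v‖ :=
  (if_neg (lt_irrefl _)).trans (if_pos rfl)

theorem dist_of_neg (hκ : κ < 0) (P Q : ModelPlane κ) :
    dist P Q = arcosh (form P Q) / √(-κ) :=
  (if_neg hκ.not_gt).trans (if_neg hκ.ne)

protected theorem dist_self (P : ModelPlane κ) : dist P P = 0 := by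
  rcases lt_trichotomy κ 0 with hκ | rfl | hκ
  · rw [dist_of_neg hκ, form_self, arcosh_zero, zero_div]
  · rw [dist_of_curvature_zero, sub_self, norm_zero]
  · rw [dist_of_pos hκ, form_self, arccos_one, zero_div]

protected theorem dist_comm (P Q : ModelPlane κ) : dist P Q = dist Q P := by
  rcases lt_trichotomy κ 0 with hκ | rfl | hκ
  · rw [dist_of_neg hκ, dist_of_neg hκ, form_comm]
  · rw [dist_of_curvature_zero, dist_of_curvature_zero, norm_sub_rev]
  · rw [dist_of_pos hκ, dist_of_pos hκ, form_comm]

theorem dist_mem_modelDistances (P Q : ModelPlane κ) : dist P Q ∈ modelDistances κ := by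
  rcases lt_trichotomy κ 0 with hκ | rfl | hκ
  · rw [dist_of_neg hκ]
    exact ⟨div_nonneg (arcosh_nonneg (one_le_form hκ.le P Q)) (sqrt_nonneg _),
      fun h => absurd h hκ.not_gt⟩
  · rw [dist_of_curvature_zero]
    exact ⟨norm_nonneg _, fun h => absurd h (lt_irrefl _)⟩
  · rw [dist_of_pos hκ]
    refine ⟨div_nonneg (arccos_nonneg _) (sqrt_nonneg _), fun _ => ?_⟩
    rw [mul_div_cancel₀ _ (sqrt_pos.2 hκ).ne']
    exact arccos_le_pi _

/-- The solution `h` of `P.t = 1 - κ * h`. In the coordinates `(h, v)` the model planes form the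
family of quadrics `‖v‖ ^ 2 = h * (2 - κ * h)`, which is a paraboloid for `κ = 0`. -/
noncomputable def height (P : ModelPlane κ) : ℝ :=
  if κ = 0 then ‖P.v‖ ^ 2 / 2 else (1 - P.t) / κ

theorem t_eq_one_sub_height (P : ModelPlane κ) : P.t = 1 - κ * P.height := by
  rw [height]
  split_ifs with hκ
  · subst hκ
    have hsq : P.t ^ 2 = 1 ^ 2 := by linarith [P.eqn]
    rw [zero_mul, sub_zero]
    exact (pow_left_inj₀ (P.pos le_rfl).le zero_le_one two_ne_zero).1 hsq
  · field_simp
    ring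

theorem norm_sq_eq_height (P : ModelPlane κ) : ‖P.v‖ ^ 2 = P.height * (2 - κ * P.height) := by
  rcases eq_or_ne κ 0 with rfl | hκ
  · rw [height, if_pos rfl]
    ring
  · have h := P.eqn
    rw [t_eq_one_sub_height] at h
    apply mul_left_cancel₀ hκ
    linarith

theorem exists_height_eq {h : ℝ} {v : EuclideanSpace ℝ (Fin 2)}
    (hv : ‖v‖ ^ 2 = h * (2 - κ * h)) (hpos : κ ≤ 0 → 0 < 1 - κ * h) :
    ∃ P : ModelPlane κ, P.height = h ∧ P.v = v := by
  refine ⟨⟨1 - κ * h, v, by rw [hv]; ring, hpos⟩, ?_, rfl⟩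
  unfold height
  split_ifs with hκ
  · subst hκ
    linarith
  · field_simp
    ring

theorem modelVersine_dist (P Q : ModelPlane κ) :
    modelVersine κ (dist P Q) = P.height + Q.height - κ * P.height * Q.height - ⟪P.v, Q.v⟫ := by
  have hform : 1 - form P Q = κ * (P.height + Q.height - κ * P.height * Q.height - ⟪P.v, Q.v⟫) := by
    rw [form, t_eq_one_sub_height P, t_eq_one_sub_height Q]
    ring
  rcases lt_trichotomy κ 0 with hκ | rfl | hκ
  · rw [modelVersine_of_neg hκ, dist_of_neg hκ, mul_div_cancel₀ _ (sqrt_pos.2 (neg_pos.2 hκ)).ne',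
      cosh_arcosh (one_le_form hκ.le P Q), hform, mul_div_cancel_left₀ _ hκ.ne]
  · rw [modelVersine_curvature_zero, dist_of_curvature_zero, norm_sub_sq_real, norm_sq_eq_height P,
      norm_sq_eq_height Q]
    ring
  · have hle := abs_le.1 (abs_form_le_one hκ P Q)
    rw [modelVersine_of_pos hκ, dist_of_pos hκ, mul_div_cancel₀ _ (sqrt_pos.2 hκ).ne',
      cos_arccos hle.1 hle.2, hform, mul_div_cancel_left₀ _ hκ.ne']

theorem modelVersine_dist_nonneg (P Q : ModelPlane κ) : 0 ≤ modelVersine κ (dist P Q) :=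
  modelVersine_nonneg (dist_mem_modelDistances P Q)

theorem dist_le_of_modelVersine_dist_le {P Q : ModelPlane κ} {R : ℝ} (hR : R ∈ modelDistances κ)
    (h : modelVersine κ (dist P Q) ≤ modelVersine κ R) : dist P Q ≤ R :=
  ((strictMonoOn_modelVersine κ).le_iff_le (dist_mem_modelDistances P Q) hR).1 h

/-- The radial projection of an ambient point `(h, v)` to `M_κ`: the ambient point has
`t² + κ ‖v‖² = (1 - κ * g) ^ 2`, and is divided by `1 - κ * g`. -/
theorem exists_radial_projection {h g : ℝ} {v : EuclideanSpace ℝ (Fin 2)}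
    (hg : h * (2 - κ * h) - ‖v‖ ^ 2 = g * (2 - κ * g)) (hκg : 0 < 1 - κ * g)
    (hpos : κ ≤ 0 → 0 < 1 - κ * h) :
    ∃ P : ModelPlane κ, ∀ Q : ModelPlane κ, (1 - κ * g) * modelVersine κ (dist P Q) =
      h + Q.height - κ * h * Q.height - ⟪v, Q.v⟫ - g := by
  obtain ⟨P, hPh, hPv⟩ : ∃ P : ModelPlane κ, P.height = (h - g) / (1 - κ * g) ∧
      P.v = (1 - κ * g)⁻¹ • v := by
    refine exists_height_eq ?_ fun hκ => ?_
    · rw [norm_smul, mul_pow, norm_inv, norm_of_nonneg hκg.le]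
      have hκg0 := hκg.ne'
      field_simp
      linarith
    · have hdiv : 1 - κ * ((h - g) / (1 - κ * g)) = (1 - κ * h) / (1 - κ * g) := by
        have hκg0 := hκg.ne'
        field_simp
        ring
      rw [hdiv]
      exact div_pos (hpos hκ) hκg
  refine ⟨P, fun Q => ?_⟩
  have hκg0 := hκg.ne'
  rw [modelVersine_dist, hPh, hPv, real_inner_smul_left]
  field_simp
  ring

section WeightedSums

variable {ι : Type*} [Fintype ι] {w : ι → ℝ} (q : ι → ModelPlane κ)

theorem sum_mul_modelVersine_dist (hw : ∑ j, w j = 1) (Q : ModelPlane κ) :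
    ∑ j, w j * modelVersine κ (dist Q (q j)) =
      ∑ j, w j * (q j).height + Q.height - κ * (∑ j, w j * (q j).height) * Q.height
        - ⟪∑ j, w j • (q j).v, Q.v⟫ := by
  have hterm : ∀ j, w j * modelVersine κ (dist Q (q j)) =
      w j * Q.height + (1 - κ * Q.height) * (w j * (q j).height) - ⟪w j • (q j).v, Q.v⟫ := by
    intro j
    rw [modelVersine_dist, real_inner_smul_left, real_inner_comm]
    ring
  simp only [hterm, Finset.sum_sub_distrib, Finset.sum_add_distrib, ← Finset.mul_sum,
    ← Finset.sum_mul, ← sum_inner, hw]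
  ring

theorem sum_mul_sum_mul_modelVersine_dist (hw : ∑ j, w j = 1) :
    ∑ i, w i * ∑ j, w j * modelVersine κ (dist (q i) (q j)) =
      (∑ j, w j * (q j).height) * (2 - κ * ∑ j, w j * (q j).height)
        - ‖∑ j, w j • (q j).v‖ ^ 2 := by
  have hnorm : ‖∑ j, w j • (q j).v‖ ^ 2 = ∑ i, w i * ∑ j, w j * ⟪(q i).v, (q j).v⟫ := by
    rw [← real_inner_self_eq_norm_sq, sum_inner]
    refine Finset.sum_congr rfl fun i _ => ?_
    simp only [real_inner_smul_left _ _ (w i), inner_sum, real_inner_smul_right]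
  simp only [modelVersine_dist]
  rw [sum_mul_sum_mul_add_sub_sub hw κ, hnorm]

theorem one_sub_sum_mul_height_pos (hκ : κ ≤ 0) (hw : w ∈ stdSimplex ℝ ι) :
    0 < 1 - κ * ∑ j, w j * (q j).height := by
  have hmem : ∑ j, w j • (q j).t ∈ Ioi (0 : ℝ) :=
    (convex_Ioi 0).sum_mem (fun j _ => hw.1 j) hw.2 fun j _ => (q j).pos hκ
  have hsum : ∑ j, w j • (q j).t = 1 - κ * ∑ j, w j * (q j).height := by
    simp only [smul_eq_mul, t_eq_one_sub_height, mul_sub, mul_one, Finset.sum_sub_distrib, hw.2,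
      Finset.mul_sum, mul_left_comm κ]
  rwa [hsum] at hmem

theorem exists_forall_modelVersine_dist_le [Nonempty ι] {M : ℝ} (hM : κ * M < 1)
    (h : ∀ w ∈ stdSimplex ℝ ι,
      ∑ i, w i * ∑ j, w j * modelVersine κ (dist (q i) (q j)) ≤ M * (2 - κ * M)) :
    ∃ P : ModelPlane κ, ∀ k, modelVersine κ (dist P (q k)) ≤ M := by
  obtain ⟨w, hw, hmax⟩ := exists_mem_stdSimplex_forall_sum_mul_le
    (A := fun i j => modelVersine κ (dist (q i) (q j))) fun i j => by rw [ModelPlane.dist_comm]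
  have hF := h w hw
  have hF0 : 0 ≤ ∑ i, w i * ∑ j, w j * modelVersine κ (dist (q i) (q j)) :=
    Finset.sum_nonneg fun i _ => mul_nonneg (hw.1 i) <| Finset.sum_nonneg fun j _ =>
      mul_nonneg (hw.1 j) (modelVersine_dist_nonneg _ _)
  set F := ∑ i, w i * ∑ j, w j * modelVersine κ (dist (q i) (q j)) with hF_def
  have hκF : κ * F < 1 := mul_lt_one_of_le hF0 hF (by linarith [sq_pos_of_pos (sub_pos.2 hM)])
  obtain ⟨g, hκg, hg⟩ := exists_mul_two_sub_eq hκF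
  have hgM : g ≤ M := (strictMonoOn_mul_two_sub κ).le_iff_le hκg hM |>.1 (hg.trans_le hF)
  obtain ⟨P, hP⟩ := exists_radial_projection
    ((sum_mul_sum_mul_modelVersine_dist q hw.2).symm.trans (hF_def.symm.trans hg.symm))
    (sub_pos.2 hκg) fun hκ => one_sub_sum_mul_height_pos q hκ hw
  refine ⟨P, fun k => le_trans ?_ hgM⟩
  refine le_of_mul_le_mul_left ?_ (sub_pos.2 hκg)
  calc (1 - κ * g) * modelVersine κ (dist P (q k))
      = ∑ j, w j * modelVersine κ (dist (q k) (q j)) - g := by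
        rw [hP, sum_mul_modelVersine_dist q hw.2]
    _ ≤ F - g := sub_le_sub_right (hmax k) g
    _ = (1 - κ * g) * g := by rw [← hg]; ring

end WeightedSums

theorem exists_forall_zero_le_form {ι : Type*} [Fintype ι] [Nonempty ι] (h : Fintype.card ι ≤ 3)
    (hκ : 0 < κ) (q : ι → ModelPlane κ) :
    ∃ P : ModelPlane κ, ∀ i, 0 ≤ form P (q i) := by
  let φ : ι → Module.Dual ℝ (ℝ × EuclideanSpace ℝ (Fin 2)) := fun i =>
    (q i).t • LinearMap.fst ℝ ℝ _ + κ • innerₛₗ ℝ (q i).v ∘ₗ LinearMap.snd ℝ ℝ _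
  obtain ⟨u, hu, hφ⟩ := exists_ne_zero_forall_nonneg φ (h.trans_eq (by simp))
  have hpos : 0 < u.1 ^ 2 + κ * ‖u.2‖ ^ 2 := by
    rcases Prod.ext_iff.not.1 hu |> not_and_or.1 with h1 | h2
    · have : 0 < u.1 ^ 2 := sq_pos_of_ne_zero h1
      positivity
    · have : 0 < ‖u.2‖ := norm_pos_iff.2 h2
      positivity
  set r := (√(u.1 ^ 2 + κ * ‖u.2‖ ^ 2))⁻¹ with hr
  have hr0 : 0 ≤ r := by positivity
  have hr_sq : r ^ 2 * (u.1 ^ 2 + κ * ‖u.2‖ ^ 2) = 1 := by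
    rw [hr, inv_pow, sq_sqrt hpos.le, inv_mul_cancel₀ hpos.ne']
  refine ⟨⟨r * u.1, r • u.2, ?_, fun h => absurd h hκ.not_ge⟩, fun i => ?_⟩
  · rw [norm_smul, norm_of_nonneg hr0, ← hr_sq]
    ring
  · have hform : r * u.1 * (q i).t + κ * ⟪r • u.2, (q i).v⟫ = r * φ i u := by
      rw [real_inner_smul_left, real_inner_comm]
      simp only [φ, LinearMap.add_apply, LinearMap.smul_apply, LinearMap.comp_apply,
        LinearMap.fst_apply, LinearMap.snd_apply, innerₛₗ_apply_apply, smul_eq_mul]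
      ring
    rw [form, hform]
    exact mul_nonneg hr0 (hφ i)

theorem exists_forall_dist_le_pi_div_two {ι : Type*} [Fintype ι] [Nonempty ι]
    (h : Fintype.card ι ≤ 3) (hκ : 0 < κ) (q : ι → ModelPlane κ) :
    ∃ P : ModelPlane κ, ∀ i, √κ * dist P (q i) ≤ π / 2 := by
  obtain ⟨P, hP⟩ := exists_forall_zero_le_form h hκ q
  refine ⟨P, fun i => ?_⟩
  rw [dist_of_pos hκ, mul_div_cancel₀ _ (sqrt_pos.2 hκ).ne']
  exact arccos_le_pi_div_two.2 (hP i)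

theorem circumradius_le_of_dist_le {a b c P : ModelPlane κ} {R : ℝ} (ha : dist P a ≤ R)
    (hb : dist P b ≤ R) (hc : dist P c ≤ R) : circumradius a b c ≤ R := by
  refine (ciInf_le ⟨0, ?_⟩ P).trans (max_le ha (max_le hb hc))
  rintro _ ⟨Q, rfl⟩
  exact (dist_mem_modelDistances Q a).1.trans (le_max_left _ _)

end ModelPlane

/-- The part of `IsCBB κ X` that does not refer to lengths of paths. Asking for positive distances
instead of distinct points makes it meaningful in pseudometric spaces. -/
def FourPointComparison (κ : ℝ) (X : Type*) [PseudoMetricSpace X] : Prop :=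
  ∀ p x y z : X, 0 < dist p x → 0 < dist p y → 0 < dist p z →
    IsSmallTriangle κ p x y → IsSmallTriangle κ p y z → IsSmallTriangle κ p z x →
      modelAngle κ p x y + modelAngle κ p y z + modelAngle κ p z x ≤ 2 * π

theorem IsCBB.fourPointComparison {κ : ℝ} {X : Type*} [MetricSpace X] (hX : IsCBB κ X) :
    FourPointComparison κ X := fun p x y z hx hy hz =>
  hX.four_point p x y z (dist_pos.1 hx) (dist_pos.1 hy) (dist_pos.1 hz)

theorem isSmallTriangle_of_dist_lt {κ : ℝ} {X : Type*} [PseudoMetricSpace X] {p x y : X}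
    (hx : 0 < κ → √κ * dist p x < π / 2) (hy : 0 < κ → √κ * dist p y < π / 2) :
    IsSmallTriangle κ p x y := fun hκ => by
  have htri := mul_le_mul_of_nonneg_left (dist_triangle_left x y p) (sqrt_nonneg κ)
  rw [lt_div_iff₀' (sqrt_pos.2 hκ), dist_comm y p]
  linarith [hx hκ, hy hκ]

namespace FourPointComparison

variable {κ : ℝ} {X : Type*} [PseudoMetricSpace X] {x : X} {p : Fin 3 → X} {R : ℝ}

theorem exists_modelVersine_dist_le (hX : FourPointComparison κ X) (hp : ∀ i, 0 < dist x (p i))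
    (hπ : 0 < κ → ∀ i, √κ * dist x (p i) < π / 2) :
    ∃ θ : Fin 3 → ℝ, ∀ i j, modelVersine κ (dist (p i) (p j)) ≤
      modelVersine κ (dist x (p i)) + modelVersine κ (dist x (p j))
        - κ * modelVersine κ (dist x (p i)) * modelVersine κ (dist x (p j))
        - modelSine κ (dist x (p i)) * modelSine κ (dist x (p j)) * cos (θ i - θ j) := by
  have hsmall : ∀ i j, IsSmallTriangle κ x (p i) (p j) := fun i j =>
    isSmallTriangle_of_dist_lt (hπ · i) (hπ · j)
  obtain ⟨θ, hθ⟩ := exists_forall_ne_cos_sub_le_cos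
    (A := fun i j => modelAngle κ x (p i) (p j)) (fun i j => modelAngle_comm _ _ _ _)
    (fun i j => modelAngle_nonneg _ _ _ _)
    (hX x (p 0) (p 1) (p 2) (hp 0) (hp 1) (hp 2) (hsmall 0 1) (hsmall 1 2) (hsmall 2 0))
  refine ⟨θ, fun i j => ?_⟩
  rcases eq_or_ne i j with rfl | hij
  · rw [dist_self, modelVersine_zero, sub_self, cos_zero, mul_one, ← sq, modelSine_sq]
    exact le_of_eq (by ring)
  · have hsin : ∀ i, 0 < modelSine κ (dist x (p i)) := fun i =>
      modelSine_pos (hp i) fun hκ => (hπ hκ i).trans (by linarith [pi_pos])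
    rw [modelVersine_dist_eq_sub_cos_modelAngle (hp i) (hp j)
      fun hκ => by linarith [hπ hκ i, hπ hκ j]]
    exact sub_le_sub_left
      (mul_le_mul_of_nonneg_left (hθ i j hij) (mul_pos (hsin i) (hsin j)).le) _

theorem sum_mul_sum_mul_modelVersine_dist_le (hX : FourPointComparison κ X)
    (hp : ∀ i, 0 < dist x (p i)) (hR : ∀ i, dist x (p i) ≤ R) (hRπ : 0 < κ → √κ * R < π / 2)
    {w : Fin 3 → ℝ} (hw : w ∈ stdSimplex ℝ (Fin 3)) :
    ∑ i, w i * ∑ j, w j * modelVersine κ (dist (p i) (p j)) ≤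
      modelVersine κ R * (2 - κ * modelVersine κ R) := by
  have hR0 : 0 ≤ R := dist_nonneg.trans (hR 0)
  have hmem : ∀ d, 0 ≤ d → d ≤ R → d ∈ modelDistances κ := fun d hd hdR => ⟨hd, fun hκ => by
    linarith [hRπ hκ, pi_pos, mul_le_mul_of_nonneg_left hdR (sqrt_nonneg κ)]⟩
  set m : Fin 3 → ℝ := fun i => modelVersine κ (dist x (p i))
  set s : Fin 3 → ℝ := fun i => modelSine κ (dist x (p i))
  obtain ⟨θ, hθ⟩ := hX.exists_modelVersine_dist_le hp fun hκ i =>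
    (mul_le_mul_of_nonneg_left (hR i) (sqrt_nonneg κ)).trans_lt (hRπ hκ)
  have hm : ∀ i, m i ∈ Icc 0 (modelVersine κ R) := fun i =>
    ⟨modelVersine_nonneg (hmem _ dist_nonneg (hR i)),
      (strictMonoOn_modelVersine κ).monotoneOn (hmem _ dist_nonneg (hR i)) (hmem R hR0 le_rfl)
        (hR i)⟩
  obtain ⟨hm0, hmR⟩ : ∑ i, w i * m i ∈ Icc 0 (modelVersine κ R) :=
    (convex_Icc _ _).sum_mem (fun i _ => hw.1 i) hw.2 fun i _ => hm i
  have hκR : κ * modelVersine κ R < 1 := curvature_mul_modelVersine_lt_one hR0 hRπ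
  have hgram : 0 ≤ ∑ i, w i * ∑ j, w j * (s i * s j * cos (θ i - θ j)) := by
    convert sum_mul_sum_mul_cos_sub_nonneg (fun i => w i * s i) θ using 2
    rw [mul_assoc, Finset.mul_sum (a := s _)]
    exact congrArg _ (Finset.sum_congr rfl fun j _ => by ring)
  calc ∑ i, w i * ∑ j, w j * modelVersine κ (dist (p i) (p j))
      ≤ ∑ i, w i * ∑ j, w j * (m i + m j - κ * m i * m j - s i * s j * cos (θ i - θ j)) :=
        Finset.sum_le_sum fun i _ => mul_le_mul_of_nonneg_left (Finset.sum_le_sum fun j _ =>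
          mul_le_mul_of_nonneg_left (hθ i j) (hw.1 j)) (hw.1 i)
    _ = (∑ i, w i * m i) * (2 - κ * ∑ i, w i * m i) -
          ∑ i, w i * ∑ j, w j * (s i * s j * cos (θ i - θ j)) :=
        sum_mul_sum_mul_add_sub_sub hw.2 κ m _
    _ ≤ (∑ i, w i * m i) * (2 - κ * ∑ i, w i * m i) := sub_le_self _ hgram
    _ ≤ modelVersine κ R * (2 - κ * modelVersine κ R) :=
        (strictMonoOn_mul_two_sub κ).monotoneOn (mul_lt_one_of_le hm0 hmR hκR) hκR hmR

theorem exists_forall_dist_le (hX : FourPointComparison κ X) {q : Fin 3 → ModelPlane κ}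
    (hpq : ∀ i j, dist (q i) (q j) = dist (p i) (p j)) (hR : ∀ i, dist x (p i) ≤ R) :
    ∃ P : ModelPlane κ, ∀ i, dist P (q i) ≤ R := by
  have hR0 : 0 ≤ R := dist_nonneg.trans (hR 0)
  by_cases hp : ∀ i, 0 < dist x (p i)
  swap
  · obtain ⟨i, hi⟩ : ∃ i, dist x (p i) = 0 := by
      simpa [dist_nonneg.lt_iff_ne'] using hp
    exact ⟨q i, fun j => by linarith [hpq i j, dist_triangle_left (p i) (p j) x, hR j]⟩
  by_cases hRπ : 0 < κ → √κ * R < π / 2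
  · have hRmem : R ∈ modelDistances κ := ⟨hR0, fun hκ => by linarith [hRπ hκ, pi_pos]⟩
    obtain ⟨P, hP⟩ := ModelPlane.exists_forall_modelVersine_dist_le q
      (curvature_mul_modelVersine_lt_one hR0 hRπ) fun w hw => by
        simpa only [hpq] using hX.sum_mul_sum_mul_modelVersine_dist_le hp hR hRπ hw
    exact ⟨P, fun i => ModelPlane.dist_le_of_modelVersine_dist_le hRmem (hP i)⟩
  · obtain ⟨hκ, hle⟩ : 0 < κ ∧ π / 2 ≤ √κ * R := by simpa using hRπ
    obtain ⟨P, hP⟩ := ModelPlane.exists_forall_dist_le_pi_div_two (by simp) hκ q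
    exact ⟨P, fun i => le_of_mul_le_mul_left ((hP i).trans hle) (sqrt_pos.2 hκ)⟩

end FourPointComparison

theorem IsComparisonTriangle.dist_eq {κ : ℝ} {X : Type*} [PseudoMetricSpace X] {a b c : X}
    {a' b' c' : ModelPlane κ} (h : IsComparisonTriangle κ a b c a' b' c') (i j : Fin 3) :
    dist (![a', b', c'] i) (![a', b', c'] j) = dist (![a, b, c] i) (![a, b, c] j) := by
  obtain ⟨hab, hbc, hca⟩ := h
  fin_cases i <;> fin_cases j <;>
    simp [ModelPlane.dist_self, hab, hbc, hca, ModelPlane.dist_comm b' a',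
      ModelPlane.dist_comm c' b', ModelPlane.dist_comm a' c', dist_comm]

theorem mainTheorem5_general {κ : ℝ} {X : Type*} [PseudoMetricSpace X]
    (hX : FourPointComparison κ X) {a b c : X} {a' b' c' : ModelPlane κ}
    (h : IsComparisonTriangle κ a b c a' b' c') : circumradius a' b' c' ≤ circumradius a b c := by
  have : Nonempty X := ⟨a⟩
  refine le_ciInf fun x => ?_
  have hR : ∀ i, dist x (![a, b, c] i) ≤ max (dist x a) (max (dist x b) (dist x c)) := by
    intro i
    fin_cases i <;> simp
  obtain ⟨P, hP⟩ := hX.exists_forall_dist_le h.dist_eq hR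
  exact ModelPlane.circumradius_le_of_dist_le (hP 0) (hP 1) (hP 2)

theorem mainTheorem5 (κ : ℝ) (X : Type*) [MetricSpace X] (hX : IsCBB κ X) : CurvGE κ X :=
  fun _ _ _ _ _ _ _ h => mainTheorem5_general hX.fourPointComparison h
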